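/- Let $H$ be a finite-dimensional complex Hilbert space of dimension $d$, and let $\|\cdot\|$ denote the operator norm. For density operators $\rho,\sigma$ on $H$ with the same spectrum, the quantum charging distance is $$D(\rho,\sigma)=\min T,$$ the minimum over all $T\ge 0$ for which there is a (measurable, possibly time-dependent) family of self-adjoint operators $V_t$, $t\in[0,T]$, with $\|V_t\|=1$ and $\sigma=U\rho U^\dagger$, where $U=U(T)=\mathrm{Texp}\big(-i\int_0^T V_t\,dt\big)$, i.e. $U(t)=1-i\int_0^t V_sU(s)\,ds$ for $0\le t\le T$. For a unitary $W$, $\ln W$ denotes the principal logarithm (eigenvalues in $i(-\pi,\pi]$). (a) Let $r_1,\dots,r_m$ be pairwise distinct reals, let $\{|r_i^k\rangle\}$ and $\{|s_i^k\rangle\}$ ($1\le i\le m$, $1\le k\le n_i$, $\sum_i n_i=d$) be orthonormal bases of $H$, and let $$\rho=\sum_{i=1}^m r_i\sum_{k=1}^{n_i}|r_i^k\rangle\langle r_i^k|,\qquad \sigma=\sum_{i=1}^m r_i\sum_{k=1}^{n_i}|s_i^k\rangle\langle s_i^k|$$ be density operators. Then the minimum defining $D(\rho,\sigma)$ is attained,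 and $$D(\rho,\sigma)=\min_{U_1,\dots,U_m}\Big\|\,i\ln\Big(\bigoplus_{i=1}^m U_i\ \sum_{i=1}^m\sum_{k=1}^{n_i}|s_i^k\rangle\langle r_i^k|\Big)\Big\|,$$ where the minimum (which is attained) is over all unitary operators $U_i$ on $\mathcal H_i=\mathrm{span}\{|s_i^k\rangle\}_{k=1}^{n_i}$. (b) Consequently $D$ depends only on the eigenspaces: if $\rho',\sigma'$ are density operators with decompositions of the same form, with pairwise distinct reals $r_i'$ and orthonormal bases $\{|r_i'^{k}\rangle\}$, $\{|s_i'^{k}\rangle\}$ such that $\mathrm{span}\{|r_i'^{k}\rangle\}_k=\mathrm{span}\{|r_i^{k}\rangle\}_k$ and $\mathrm{span}\{|s_i'^{k}\rangle\}_k=\mathrm{span}\{|s_i^{k}\rangle\}_k$ for every $i$, then $D(\rho',\sigma')=D(\rho,\sigma)$. (c) If $\rho=\sum_{i=1}^d r_i|r_i\rangle\langle r_i|$ and $\sigma=\sum_{i=1}^d r_i|s_i\rangle\langle s_i|$ are density operators with pairwise distinct $r_i$ and orthonormal bases $\{|r_i\rangle\}$, $\{|s_i\rangle\}$, then $$D(\rho,\sigma)=\min_{\phi_1,\dots,\phi_d\in\mathbb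 R}\Big\|\,i\ln\Big(\sum_{i=1}^d e^{i\phi_i}|s_i\rangle\langle r_i|\Big)\Big\|.$$ -/

import Mathlib

namespace QuantumCharging

open MeasureTheory Set

variable {H : Type*} [NormedAddCommGroup H] [InnerProductSpace ℂ H]
  [FiniteDimensional ℂ H] [CompleteSpace H]

/-- The operator `|x⟩⟨y|`, that is `z ↦ ⟪y, z⟫ x`. -/
noncomputable def ketBra (x y : H) : H →L[ℂ] H :=
  InnerProductSpace.rankOne ℂ x y

/-- Density operators: positive operators of trace one. -/
def IsDensityOperator (ρ : H →L[ℂ] H) : Prop :=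
  ρ.IsPositive ∧ LinearMap.trace ℂ H (ρ : H →ₗ[ℂ] H) = 1

/-- A charging Hamiltonian on `[0, T]`: a measurable, possibly time-dependent family of
self-adjoint operators of operator norm one. -/
structure IsChargingHamiltonian (V : ℝ → H →L[ℂ] H) (T : ℝ) : Prop where
  measurable : AEStronglyMeasurable V (volume.restrict (Icc 0 T))
  selfAdjoint : ∀ t ∈ Icc 0 T, IsSelfAdjoint (V t)
  norm_eq_one : ∀ t ∈ Icc 0 T, ‖V t‖ = 1

/-- `U t` is the time-ordered exponential `Texp (-i ∫₀ᵗ V_s ds)` for `t ∈ [0, T]`: the continuous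
solution of the Schrödinger equation `U' = -i V U`, `U 0 = 1`, in integrated form. -/
def IsTimeOrderedExp (V : ℝ → H →L[ℂ] H) (T : ℝ) (U : ℝ → H →L[ℂ] H) : Prop :=
  ContinuousOn U (Icc 0 T) ∧
    ∀ t ∈ Icc 0 T, U t = 1 - Complex.I • ∫ s in (0 : ℝ)..t, V s * U s

/-- The times `T ≥ 0` in which some charging Hamiltonian drives `ρ` to `σ`. -/
def chargingTimes (ρ σ : H →L[ℂ] H) : Set ℝ :=
  {T | 0 ≤ T ∧ ∃ V U : ℝ → H →L[ℂ] H, IsChargingHamiltonian V T ∧ IsTimeOrderedExp V T U ∧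
    σ = U T * ρ * star (U T)}

/-- The quantum charging distance. -/
noncomputable def chargingDistance (ρ σ : H →L[ℂ] H) : ℝ :=
  sInf (chargingTimes ρ σ)

/-- `‖i ln W‖` in operator norm, for a unitary `W` on a finite-dimensional space; `ln` is the
principal logarithm (eigenvalue angles in `(-π, π]`), applied to the eigenvalues of `W`. -/
noncomputable def normLog (W : H →L[ℂ] H) : ℝ :=
  ‖Complex.I • cfc Complex.log W‖

/-- `∑ᵢ rᵢ ∑ₖ |bᵢᵏ⟩⟨bᵢᵏ|`. -/
noncomputable def spectralSum {m : ℕ} {n : Fin m → ℕ} (r : Fin m → ℝ)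
    (b : OrthonormalBasis (Σ i, Fin (n i)) ℂ H) : H →L[ℂ] H :=
  ∑ i, (r i : ℂ) • ∑ k, ketBra (b ⟨i, k⟩) (b ⟨i, k⟩)

/-- The subspace spanned by the `i`-th block of the basis. -/
def blockSpan {m : ℕ} {n : Fin m → ℕ}
    (b : OrthonormalBasis (Σ i, Fin (n i)) ℂ H) (i : Fin m) : Submodule ℂ H :=
  Submodule.span ℂ (range fun k : Fin (n i) => b ⟨i, k⟩)

/-- The operator `⨁ᵢ Uᵢ` on `H`, for operators `Uᵢ` on subspaces `K i` of `H` (which, where it is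
used, are mutually orthogonal and together span `H`). -/
noncomputable def blockSum {m : ℕ} (K : Fin m → Submodule ℂ H)
    (U : ∀ i, K i ≃ₗᵢ[ℂ] K i) : H →L[ℂ] H :=
  ∑ i, (K i).subtypeL ∘L (U i : K i →L[ℂ] K i) ∘L (K i).orthogonalProjectionOnto

end QuantumCharging

/-! The set of unitaries conjugating `ρ` into `σ` (`conjugators`) carries the whole problem: `D` is
the least value of `normLog` on it.

Lower bound (`IsTimeOrderedExp.normLog_le`): if `U T` is reached in time `T`, take a unit
eigenvector `x` of `U T` whose eigenvalue has the largest angle. Since `‖V t‖ = 1` and `U t` is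
unitary, `t ↦ U t x` runs on the unit sphere with speed at most one, so that angle, which is
`normLog (U T)`, is at most `T`. Upper bound (`normLog_mem_chargingTimes`): the normalised generator
`i ln W`, held constant, reaches `W` in time exactly `normLog W`. The minimum exists because the
conjugators form a compact set on which `normLog` is continuous (`isLeast_chargingDistance`).

The rest is linear algebra: a unitary is a conjugator exactly when it maps eigenspaces to
corresponding eigenspaces (`mem_conjugators_spectralSum_iff`). This makes the eigenvalues irrelevant
and parametrises the conjugators by block unitaries, or by phases when the spectrum is simple. -/

namespace QuantumCharging

open MeasureTheory Set

/-! ### Angles along curves on the unit sphere. -/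

section Sphere

variable {V : Type*} [NormedAddCommGroup V] [InnerProductSpace ℝ V]

open InnerProductGeometry

/-- On the unit sphere the angle exceeds the chord length by at most a cubic term. -/
theorem angle_le_of_norm_sub_le {x y : V} (hx : ‖x‖ = 1) (hy : ‖y‖ = 1) {h : ℝ}
    (hxy : ‖y - x‖ ≤ h) : angle x y ≤ h + h ^ 3 / 2 := by
  have hh : 0 ≤ h := (norm_nonneg _).trans hxy
  have hθ0 := angle_nonneg x y
  have hθπ := angle_le_pi x y
  have hcos : inner ℝ x y = Real.cos (angle x y) := inner_eq_cos_angle_of_norm_eq_one hx hy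
  set θ := angle x y
  have hsin0 : 0 ≤ Real.sin (θ / 2) :=
    Real.sin_nonneg_of_nonneg_of_le_pi (by linarith) (by linarith)
  have hchord : ‖y - x‖ ^ 2 = (2 * Real.sin (θ / 2)) ^ 2 := by
    have h2 : Real.cos θ = 2 * Real.cos (θ / 2) ^ 2 - 1 := by
      rw [← Real.cos_two_mul]; ring_nf
    rw [norm_sub_sq_real, hx, hy, real_inner_comm, hcos, h2]
    linarith [Real.sin_sq_add_cos_sq (θ / 2)]
  have hsin : 2 * Real.sin (θ / 2) ≤ h := by
    rw [← (sq_eq_sq₀ (norm_nonneg _) (by positivity)).1 hchord]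
    exact hxy
  have hpi := Real.pi_lt_four
  have hpi0 := Real.pi_pos
  -- Jordan's inequality gives the crude bound `θ / 2 ≤ π h / 4 ≤ h`, which later turns the cubic
  -- error in `θ` into one in `h`.
  have hle : θ / 2 ≤ h := by
    have hj := Real.mul_le_sin (x := θ / 2) (by linarith) (by linarith)
    have : θ / 2 = Real.pi / 4 * (2 * (2 / Real.pi * (θ / 2))) := by field_simp; norm_num
    rw [this]
    calc Real.pi / 4 * (2 * (2 / Real.pi * (θ / 2))) ≤ Real.pi / 4 * h := by gcongr; linarith
      _ ≤ 1 * h := by gcongr; linarith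
      _ = h := one_mul h
  rcases hθ0.eq_or_lt with h0 | h0
  · rw [← h0]; positivity
  · have hc := Real.sin_gt_sub_cube (x := θ / 2) (by linarith)
    have : (θ / 2) ^ 3 ≤ h ^ 3 := by gcongr
    have : 0 ≤ h ^ 3 := by positivity
    linarith

/-- A curve on the unit sphere of speed at most one reaches an angle at most the elapsed time. -/
theorem angle_le_of_unit_speed {f : ℝ → V} {T : ℝ} (hT : 0 ≤ T)
    (hf : ∀ t ∈ Icc 0 T, ‖f t‖ = 1)
    (hspeed : ∀ s t, 0 ≤ s → s ≤ t → t ≤ T → ‖f t - f s‖ ≤ t - s) :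
    angle (f 0) (f T) ≤ T := by
  -- Cut `[0, T]` into `N` equal pieces and add the angles. The cubic errors total `N (T / N) ^ 3 /
  -- 2`, which vanishes as `N → ∞`.
  have key : ∀ N : ℕ, 0 < N →
      ∀ k : ℕ, k ≤ N → angle (f 0) (f (k * (T / N))) ≤ k * (T / N + (T / N) ^ 3 / 2) := by
    intro N hN0 k
    have hN0' : (0 : ℝ) < N := by exact_mod_cast hN0
    have hmem : ∀ j : ℕ, j ≤ N → (j : ℝ) * (T / N) ∈ Icc 0 T := fun j hj => by
      refine ⟨by positivity, ?_⟩
      calc (j : ℝ) * (T / N) ≤ N * (T / N) := by gcongr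
        _ = T := by field_simp
    induction k with
    | zero =>
      intro _
      have : f 0 ≠ 0 := fun h => by simpa [h] using hf 0 ⟨le_rfl, hT⟩
      simp [angle_self this]
    | succ k ih =>
      intro hk
      have hm := hmem k (by omega)
      have hm' := hmem (k + 1) hk
      have hstep := hspeed (k * (T / N)) ((k + 1 : ℕ) * (T / N)) hm.1
        (by push_cast; linarith [show 0 ≤ T / N by positivity]) hm'.2
      have := angle_le_of_norm_sub_le (hf _ hm) (hf _ hm') (h := T / N)
        (hstep.trans (by push_cast; linarith))
      have tri := angle_le_angle_add_angle (f 0) (f (k * (T / N))) (f ((k + 1 : ℕ) * (T / N)))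
      have := ih (by omega)
      push_cast at *
      linarith
  have hlim : Filter.Tendsto (fun N : ℕ => T + T ^ 3 / 2 * ((N : ℝ)⁻¹ * (N : ℝ)⁻¹))
      Filter.atTop (nhds (T + T ^ 3 / 2 * (0 * 0))) :=
    ((tendsto_inv_atTop_nhds_zero_nat.mul tendsto_inv_atTop_nhds_zero_nat).const_mul _).const_add _
  rw [mul_zero, mul_zero, add_zero] at hlim
  refine ge_of_tendsto hlim ?_
  filter_upwards [Filter.eventually_gt_atTop 0] with N hN0
  have hN0' : (N : ℝ) ≠ 0 := by exact_mod_cast hN0.ne'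
  have := key N hN0 N le_rfl
  rw [mul_div_cancel₀ _ hN0'] at this
  calc angle (f 0) (f T) ≤ N * (T / N + (T / N) ^ 3 / 2) := this
    _ = T + T ^ 3 / 2 * ((N : ℝ)⁻¹ * (N : ℝ)⁻¹) := by field_simp

end Sphere

/-! ### Unitarity of the time-ordered exponential. -/

/-- A function with quadratically small increments is constant. -/
theorem eq_of_norm_sub_le_sq {E : Type*} [NormedAddCommGroup E] [NormedSpace ℝ E] {f : ℝ → E}
    {T K : ℝ} (hf : ∀ s t, 0 ≤ s → s ≤ t → t ≤ T → ‖f t - f s‖ ≤ K * (t - s) ^ 2)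
    (hc : ContinuousOn f (Icc 0 T)) :
    ∀ t ∈ Icc 0 T, f t = f 0 := by
  refine constant_of_has_deriv_right_zero hc fun x hx => ?_
  rw [← hasDerivWithinAt_Ioi_iff_Ici, hasDerivWithinAt_iff_isLittleO]
  have hO : (fun x' => f x' - f x - (x' - x) • (0 : E)) =O[nhdsWithin x (Ioi x)]
      fun x' => (x' - x) ^ 2 := by
    refine Asymptotics.IsBigO.of_bound K ?_
    filter_upwards [Ioo_mem_nhdsGT hx.2] with t ht
    simpa using hf x t hx.1 ht.1.le ht.2.le
  refine hO.trans_isLittleO ?_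
  have := (Asymptotics.isLittleO_pow_id (𝕜 := ℝ) one_lt_two).comp_tendsto
    (k := fun t : ℝ => t - x) (l' := nhdsWithin x (Ioi x)) ?_
  · exact this
  · have : Filter.Tendsto (fun t : ℝ => t - x) (nhds x) (nhds (x - x)) :=
      (continuous_id.sub continuous_const).tendsto x
    rw [sub_self] at this
    exact this.mono_left nhdsWithin_le_nhds

variable {H : Type*} [NormedAddCommGroup H] [InnerProductSpace ℂ H]
  [FiniteDimensional ℂ H] [CompleteSpace H]

section Evolution

variable {V U : ℝ → H →L[ℂ] H} {T : ℝ}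

omit [FiniteDimensional ℂ H] in
theorem IsChargingHamiltonian.integrableOn (hV : IsChargingHamiltonian V T) :
    IntegrableOn V (Icc 0 T) :=
  IntegrableOn.of_bound (by simp) hV.measurable 1
    ((ae_restrict_iff' measurableSet_Icc).2 (.of_forall fun t ht => (hV.norm_eq_one t ht).le))

theorem IsChargingHamiltonian.integrableOn_mul (hV : IsChargingHamiltonian V T)
    (hU : ContinuousOn U (Icc 0 T)) : IntegrableOn (fun s => V s * U s) (Icc 0 T) := by
  obtain ⟨C, hC⟩ := isCompact_Icc.exists_bound_of_continuousOn hU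
  refine IntegrableOn.of_bound (by simp)
    (hV.measurable.mul (hU.aestronglyMeasurable measurableSet_Icc)) C
    ((ae_restrict_iff' measurableSet_Icc).2 (.of_forall fun t ht => ?_))
  calc ‖V t * U t‖ ≤ ‖V t‖ * ‖U t‖ := norm_mul_le _ _
    _ ≤ 1 * C := by rw [hV.norm_eq_one t ht]; gcongr; exact hC t ht
    _ = C := one_mul C

theorem _root_.MeasureTheory.IntegrableOn.intervalIntegrable_of_mem_Icc {E : Type*}
    [NormedAddCommGroup E] {f : ℝ → E} {a b s t : ℝ} (hf : IntegrableOn f (Icc a b))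
    (hs : s ∈ Icc a b) (ht : t ∈ Icc a b) : IntervalIntegrable f volume s t :=
  (hf.mono_set (uIcc_subset_Icc hs ht)).intervalIntegrable

theorem IsTimeOrderedExp.sub_eq (hV : IsChargingHamiltonian V T) (hU : IsTimeOrderedExp V T U)
    {s t : ℝ} (hs : s ∈ Icc 0 T) (ht : t ∈ Icc 0 T) :
    U t - U s = -(Complex.I • ∫ r in s..t, V r * U r) := by
  have h0 : (0 : ℝ) ∈ Icc 0 T := ⟨le_rfl, hs.1.trans hs.2⟩
  have hi := hV.integrableOn_mul hU.1
  rw [hU.2 t ht, hU.2 s hs, ← intervalIntegral.integral_interval_sub_left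
    (hi.intervalIntegrable_of_mem_Icc h0 ht) (hi.intervalIntegrable_of_mem_Icc h0 hs), smul_sub]
  abel

theorem IsTimeOrderedExp.norm_sub_le (hV : IsChargingHamiltonian V T)
    (hU : IsTimeOrderedExp V T U) {C : ℝ} (hC : ∀ t ∈ Icc 0 T, ‖U t‖ ≤ C) {s t : ℝ}
    (hs : 0 ≤ s) (hst : s ≤ t) (ht : t ≤ T) : ‖U t - U s‖ ≤ C * (t - s) := by
  rw [hU.sub_eq hV ⟨hs, hst.trans ht⟩ ⟨hs.trans hst, ht⟩, norm_neg, norm_smul, Complex.norm_I,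
    one_mul, ← abs_of_nonneg (sub_nonneg.2 hst)]
  refine intervalIntegral.norm_integral_le_of_norm_le_const fun r hr => ?_
  rw [uIoc_of_le hst] at hr
  have hr' : r ∈ Icc 0 T := ⟨hs.trans hr.1.le, hr.2.trans ht⟩
  refine (norm_mul_le _ _).trans ?_
  rw [hV.norm_eq_one r hr', one_mul]
  exact hC r hr'

omit [FiniteDimensional ℂ H] in
theorem isSelfAdjoint_intervalIntegral {s t : ℝ} (h : ∀ r ∈ uIoc s t, IsSelfAdjoint (V r)) :
    IsSelfAdjoint (∫ r in s..t, V r) := by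
  have hstar : star (∫ r in s..t, V r) = ∫ r in s..t, star (V r) := by
    simp only [intervalIntegral.intervalIntegral_eq_integral_uIoc, star_smul, star_trivial]
    congr 1
    -- A continuous linear equivalence commutes with the integral even without integrability.
    exact ((starL' ℝ : (H →L[ℂ] H) ≃L[ℝ] (H →L[ℂ] H)).integral_comp_comm _).symm
  rw [IsSelfAdjoint, hstar]
  refine intervalIntegral.integral_congr_ae (.of_forall fun r hr => ?_)
  exact h r hr

/-- As `V` is only measurable, `U` need not be differentiable everywhere. Instead of differentiating
`U† U`, its increments are shown to be quadratically small. -/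
theorem IsTimeOrderedExp.star_mul_self (hT : 0 ≤ T) (hV : IsChargingHamiltonian V T)
    (hU : IsTimeOrderedExp V T U) : ∀ t ∈ Icc 0 T, star (U t) * U t = 1 := by
  obtain ⟨C, hC⟩ := isCompact_Icc.exists_bound_of_continuousOn hU.1
  have h0 : (0 : ℝ) ∈ Icc 0 T := ⟨le_rfl, hT⟩
  have hC0 : 0 ≤ C := (norm_nonneg _).trans (hC 0 h0)
  have hU0 : U 0 = 1 := by simpa using hU.2 0 h0
  intro t ht
  have := eq_of_norm_sub_le_sq (f := fun t => star (U t) * U t) (T := T) (K := 3 * C ^ 2) ?_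
    (hU.1.star.mul hU.1) t ht
  · simpa [hU0] using this
  intro s t hs hst ht
  have hs' : s ∈ Icc 0 T := ⟨hs, hst.trans ht⟩
  have ht' : t ∈ Icc 0 T := ⟨hs.trans hst, ht⟩
  have hsub : ∀ r ∈ uIoc s t, r ∈ Icc 0 T ∧ s ≤ r ∧ r ≤ t := fun r hr => by
    rw [uIoc_of_le hst] at hr
    exact ⟨⟨hs.trans hr.1.le, hr.2.trans ht⟩, hr.1.le, hr.2⟩
  set B := ∫ r in s..t, V r with hB
  set F := ∫ r in s..t, V r * (U r - U s) with hF
  have hBs : star B = B := isSelfAdjoint_intervalIntegral fun r hr => hV.selfAdjoint r (hsub r hr).1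
  have hFn : ‖F‖ ≤ C * (t - s) ^ 2 := by
    have : ‖F‖ ≤ C * (t - s) * |t - s| := by
      refine intervalIntegral.norm_integral_le_of_norm_le_const fun r hr => ?_
      obtain ⟨hr', hsr, hrt⟩ := hsub r hr
      refine (norm_mul_le _ _).trans ?_
      rw [hV.norm_eq_one r hr', one_mul]
      exact (hU.norm_sub_le hV hC hs hsr hr'.2).trans (by gcongr)
    rwa [abs_of_nonneg (sub_nonneg.2 hst), mul_assoc, ← sq] at this
  set D := U t - U s with hD
  have hDn : ‖D‖ ≤ C * (t - s) := hU.norm_sub_le hV hC hs hst ht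
  have hDe : D = -(Complex.I • (B * U s + F)) := by
    rw [hD, hU.sub_eq hV hs' ht']
    congr 2
    have hi : IntervalIntegrable (fun r => V r * U s) volume s t :=
      IntegrableOn.intervalIntegrable_of_mem_Icc (hV.integrableOn.mul_const (U s)) hs' ht'
    have hi' := (hV.integrableOn_mul hU.1).intervalIntegrable_of_mem_Icc hs' ht'
    have hF' : F = (∫ r in s..t, V r * U r) - ∫ r in s..t, V r * U s := by
      rw [hF, ← intervalIntegral.integral_sub hi' hi]
      simp only [mul_sub]
    have hBU : B * U s = ∫ r in s..t, V r * U s :=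
      (((ContinuousLinearMap.mul ℝ (H →L[ℂ] H)).flip (U s)).intervalIntegral_comp_comm
        (hV.integrableOn.intervalIntegrable_of_mem_Icc hs' ht')).symm
    rw [hF', hBU]; abel
  have hUt : U t = U s + D := by rw [hD]; abel
  -- The first-order terms `∓ i U_s† B U_s` cancel because `B` is self-adjoint. Each of the three
  -- terms left is at most `C² (t - s)²` in norm.
  have hfin : star (U t) * U t - star (U s) * U s =
      -(Complex.I • (star (U s) * F)) + Complex.I • (star F * U s) + star D * D := by
    have hsD : star D = Complex.I • (star (U s) * B + star F) := by
      rw [hDe, star_neg, star_smul, star_add, star_mul, hBs]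
      simp [add_comm]
    have h1 : star (U s) * D = -(Complex.I • (star (U s) * B * U s + star (U s) * F)) := by
      rw [hDe, mul_neg, mul_smul_comm, mul_add, mul_assoc]
    have h2 : star D * U s = Complex.I • (star (U s) * B * U s + star F * U s) := by
      rw [hsD, smul_mul_assoc, add_mul]
    rw [hUt, star_add, add_mul, mul_add, mul_add, h1, h2, smul_add, smul_add]
    abel
  have hUs := hC s hs'
  change ‖star (U t) * U t - star (U s) * U s‖ ≤ _
  rw [hfin]
  calc _ ≤ ‖star (U s) * F‖ + ‖star F * U s‖ + ‖star D * D‖ := by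
        refine (norm_add_le _ _).trans ?_
        gcongr
        refine (norm_add_le _ _).trans ?_
        simp [norm_smul]
    _ ≤ C * (C * (t - s) ^ 2) + (C * (t - s) ^ 2) * C + (C * (t - s)) * (C * (t - s)) := by
        have : 0 ≤ t - s := sub_nonneg.2 hst
        gcongr
        · exact (norm_mul_le _ _).trans (by rw [norm_star]; gcongr)
        · exact (norm_mul_le _ _).trans (by rw [norm_star]; gcongr)
        · exact (norm_mul_le _ _).trans (by rw [norm_star]; gcongr)
    _ = 3 * C ^ 2 * (t - s) ^ 2 := by ring

theorem mem_unitary_of_star_mul_self {W : H →L[ℂ] H} (h : star W * W = 1) :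
    W ∈ unitary (H →L[ℂ] H) := by
  refine Unitary.mem_iff.2 ⟨h, ?_⟩
  have h' : (star W : H →L[ℂ] H).toLinearMap * W.toLinearMap = 1 :=
    congrArg ContinuousLinearMap.toLinearMap h
  rw [mul_eq_one_comm] at h'
  ext x
  exact LinearMap.congr_fun h' x

theorem IsTimeOrderedExp.mem_unitary (hV : IsChargingHamiltonian V T)
    (hU : IsTimeOrderedExp V T U) {t : ℝ} (ht : t ∈ Icc 0 T) : U t ∈ unitary (H →L[ℂ] H) :=
  mem_unitary_of_star_mul_self (hU.star_mul_self (ht.1.trans ht.2) hV t ht)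

end Evolution

/-! ### The logarithm of a unitary and the continuity of its norm. -/

section Log

variable {W : H →L[ℂ] H}

omit [CompleteSpace H] in
theorem finite_spectrum (W : H →L[ℂ] H) : (spectrum ℂ W).Finite := by
  rw [ContinuousLinearMap.spectrum_eq]
  exact Module.End.finite_spectrum _

omit [CompleteSpace H] in
theorem continuousOn_spectrum (f : ℂ → ℂ) (W : H →L[ℂ] H) : ContinuousOn f (spectrum ℂ W) :=
  (finite_spectrum W).continuousOn f

omit [FiniteDimensional ℂ H] in
theorem norm_eq_one_of_mem_spectrum (hW : W ∈ unitary (H →L[ℂ] H)) {z : ℂ}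
    (hz : z ∈ spectrum ℂ W) : ‖z‖ = 1 := by
  simpa using spectrum.subset_circle_of_unitary hW hz

omit [FiniteDimensional ℂ H] in
theorem isStarNormal_of_mem_unitary (hW : W ∈ unitary (H →L[ℂ] H)) : IsStarNormal W :=
  ⟨by rw [Commute, SemiconjBy, (Unitary.mem_iff.1 hW).1, (Unitary.mem_iff.1 hW).2]⟩

theorem log_eq_arg_mul_I {z : ℂ} (hz : ‖z‖ = 1) : Complex.log z = Complex.arg z * Complex.I := by
  rw [Complex.log, hz]; simp

theorem abs_arg_eq_arccos {z : ℂ} (hz : ‖z‖ = 1) : |Complex.arg z| = Real.arccos z.re := by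
  have h0 : z ≠ 0 := fun h => by simp [h] at hz
  have : z.re = Real.cos |Complex.arg z| := by
    rw [Real.cos_abs, Complex.cos_arg h0, hz, div_one]
  rw [this, Real.arccos_cos (abs_nonneg _) (Complex.abs_arg_le_pi z)]

/-- The principal logarithm jumps at `-1`, but on the circle its modulus `|arg z| = arccos (re z)`
is continuous. This form makes `normLog` continuous on the unitaries. -/
theorem normLog_eq_norm_cfc_arccos (hW : W ∈ unitary (H →L[ℂ] H)) :
    normLog W = ‖cfc (fun z : ℂ => (Real.arccos z.re : ℂ)) W‖ := by
  have hn := isStarNormal_of_mem_unitary hW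
  have h : ∀ f g : ℂ → ℂ, (∀ z ∈ spectrum ℂ W, ‖f z‖ ≤ ‖g z‖) → ‖cfc f W‖ ≤ ‖cfc g W‖ :=
    fun f g hfg => norm_cfc_le (norm_nonneg _) fun z hz =>
      (hfg z hz).trans (norm_apply_le_norm_cfc g W hz (continuousOn_spectrum _ _))
  have he : ∀ z ∈ spectrum ℂ W, ‖Complex.log z‖ = ‖(Real.arccos z.re : ℂ)‖ := fun z hz => by
    have h1 := norm_eq_one_of_mem_spectrum hW hz
    rw [log_eq_arg_mul_I h1, norm_mul, Complex.norm_I, mul_one, Complex.norm_real,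
      Complex.norm_real, Real.norm_eq_abs, abs_arg_eq_arccos h1,
      Real.norm_of_nonneg (Real.arccos_nonneg _)]
  rw [normLog, norm_smul, Complex.norm_I, one_mul]
  exact le_antisymm (h _ _ fun z hz => (he z hz).le) (h _ _ fun z hz => (he z hz).ge)

theorem continuousOn_normLog : ContinuousOn normLog (unitary (H →L[ℂ] H) : Set (H →L[ℂ] H)) := by
  have h : ContinuousOn (cfc fun z : ℂ => (Real.arccos z.re : ℂ))
      {W : H →L[ℂ] H | IsStarNormal W ∧ spectrum ℂ W ⊆ Metric.sphere 0 1} :=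
    continuousOn_cfc (H →L[ℂ] H) (isCompact_sphere 0 1) _
      (Complex.continuous_ofReal.comp (Real.continuous_arccos.comp Complex.continuous_re)).continuousOn
  refine (h.norm.mono fun W hW => ?_).congr fun W hW => normLog_eq_norm_cfc_arccos hW
  exact ⟨isStarNormal_of_mem_unitary hW, spectrum.subset_circle_of_unitary hW⟩

/-- `‖i ln W‖` is the largest angle by which `W` rotates an eigenvector. -/
theorem exists_arccos_inner_eq_normLog [Nontrivial H] (hW : W ∈ unitary (H →L[ℂ] H)) :
    ∃ x : H, ‖x‖ = 1 ∧ Real.arccos (inner ℂ x (W x)).re = normLog W := by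
  have hn := isStarNormal_of_mem_unitary hW
  rw [normLog_eq_norm_cfc_arccos hW]
  obtain ⟨⟨z, hz, hzn⟩, -⟩ := IsGreatest.norm_cfc (fun z : ℂ => (Real.arccos z.re : ℂ)) W
    (continuousOn_spectrum _ _)
  simp only [Complex.norm_real, Real.norm_of_nonneg (Real.arccos_nonneg _)] at hzn
  rw [← hzn]
  rw [ContinuousLinearMap.spectrum_eq] at hz
  obtain ⟨v, hv⟩ := (Module.End.HasEigenvalue.of_mem_spectrum hz).exists_hasEigenvector
  have hv0 : (‖v‖ : ℂ) ≠ 0 := by exact_mod_cast norm_ne_zero_iff.2 hv.2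
  have hWv : W v = z • v := hv.apply_eq_smul
  have hu : ‖(‖v‖ : ℂ)⁻¹ • v‖ = 1 := by
    rw [norm_smul, norm_inv, Complex.norm_real, norm_norm, inv_mul_cancel₀ (norm_ne_zero_iff.2 hv.2)]
  refine ⟨(‖v‖ : ℂ)⁻¹ • v, hu, ?_⟩
  rw [map_smul, hWv, smul_comm, inner_smul_right, inner_self_eq_norm_sq_to_K, hu]
  simp

theorem exp_cfc_log (hW : W ∈ unitary (H →L[ℂ] H)) : NormedSpace.exp (cfc Complex.log W) = W := by
  have hn := isStarNormal_of_mem_unitary hW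
  rw [← CFC.exp_eq_normedSpace_exp (𝕜 := ℂ) (cfc_predicate _ _), ← Complex.exp_eq_exp_ℂ,
    ← cfc_comp' Complex.exp Complex.log W (by fun_prop) (continuousOn_spectrum _ _)]
  conv_rhs => rw [← cfc_id' ℂ W]
  refine cfc_congr fun z hz => Complex.exp_log fun h => ?_
  simpa [h] using norm_eq_one_of_mem_spectrum hW hz

theorem isSelfAdjoint_I_smul_cfc_log (hW : W ∈ unitary (H →L[ℂ] H)) :
    IsSelfAdjoint (Complex.I • cfc Complex.log W) := by
  have hn := isStarNormal_of_mem_unitary hW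
  rw [← cfc_smul _ _ _ (continuousOn_spectrum _ _), IsSelfAdjoint, ← cfc_star]
  refine cfc_congr fun z hz => ?_
  simp only [log_eq_arg_mul_I (norm_eq_one_of_mem_spectrum hW hz)]
  rw [smul_eq_mul, mul_left_comm]
  simp

end Log

/-! ### Charging times and the minimum over conjugating unitaries. -/

section Times

variable {ρ σ : H →L[ℂ] H}

theorem IsTimeOrderedExp.normLog_le [Nontrivial H] {V U : ℝ → H →L[ℂ] H} {T : ℝ} (hT : 0 ≤ T)
    (hV : IsChargingHamiltonian V T) (hU : IsTimeOrderedExp V T U) : normLog (U T) ≤ T := by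
  have huni : ∀ t ∈ Icc 0 T, U t ∈ unitary (H →L[ℂ] H) := fun t ht => hU.mem_unitary hV ht
  have hU0 : U 0 = 1 := by simpa using hU.2 0 ⟨le_rfl, hT⟩
  obtain ⟨x, hx, hxT⟩ := exists_arccos_inner_eq_normLog (huni T ⟨hT, le_rfl⟩)
  have hiso : ∀ t ∈ Icc 0 T, ‖U t x‖ = 1 := fun t ht => by
    rw [← hx]
    exact (ContinuousLinearMap.norm_map_iff_adjoint_comp_self (U t)).2 (Unitary.mem_iff.1 (huni t ht)).1 x
  have hspeed : ∀ s t, 0 ≤ s → s ≤ t → t ≤ T → ‖U t x - U s x‖ ≤ t - s := fun s t hs hst ht => by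
    have h1 := hU.norm_sub_le hV (C := 1)
      (fun t ht => (CStarRing.norm_of_mem_unitary (huni t ht)).le) hs hst ht
    have h2 := (U t - U s).le_opNorm x
    rw [hx, mul_one] at h2
    rw [one_mul] at h1
    exact h2.trans h1
  -- Angles are taken for the real inner product `re ⟪·, ·⟫`, which matches the `arccos` of the real
  -- part above.
  let _ := InnerProductSpace.rclikeToReal ℂ H
  have := angle_le_of_unit_speed (f := fun t => U t x) hT hiso hspeed
  rw [InnerProductGeometry.angle, hiso T ⟨hT, le_rfl⟩, hiso 0 ⟨le_rfl, hT⟩, hU0,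
    real_inner_eq_re_inner ℂ] at this
  rw [← hxT]
  simpa using this

omit [FiniteDimensional ℂ H] in
theorem isTimeOrderedExp_exp (A : H →L[ℂ] H) (T : ℝ) :
    IsTimeOrderedExp (fun _ => A) T fun t => NormedSpace.exp (t • (-(Complex.I • A))) := by
  have hd : ∀ t : ℝ, HasDerivAt (fun t : ℝ => NormedSpace.exp (t • (-(Complex.I • A))))
      ((-(Complex.I • A)) * NormedSpace.exp (t • (-(Complex.I • A)))) t := fun t =>
    hasDerivAt_exp_smul_const' (𝕂 := ℝ) _ t
  have hc : Continuous fun t : ℝ => NormedSpace.exp (t • (-(Complex.I • A))) :=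
    continuous_iff_continuousAt.2 fun t => (hd t).continuousAt
  refine ⟨hc.continuousOn, fun t _ => ?_⟩
  have := intervalIntegral.integral_eq_sub_of_hasDerivAt (a := 0) (b := t) (fun s _ => hd s)
    ((continuous_const.mul hc).intervalIntegrable _ _)
  simp only [zero_smul, NormedSpace.exp_zero, neg_mul, smul_mul_assoc,
    intervalIntegral.integral_neg, intervalIntegral.integral_smul] at this
  rw [sub_eq_add_neg, this]
  abel

theorem normLog_mem_chargingTimes [Nontrivial H] {W : H →L[ℂ] H} (hW : W ∈ unitary (H →L[ℂ] H))
    (h : σ = W * ρ * star W) : normLog W ∈ chargingTimes ρ σ := by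
  obtain ⟨A, hA, hA1, hWA⟩ : ∃ A : H →L[ℂ] H, IsSelfAdjoint A ∧ ‖A‖ = 1 ∧
      Complex.I • cfc Complex.log W = normLog W • A := by
    rcases eq_or_ne (normLog W) 0 with h0 | h0
    -- Here the charging time is zero, but norm one is still required at `t = 0`. Any norm-one
    -- self-adjoint operator serves.
    · refine ⟨1, .one _, norm_one, ?_⟩
      rw [h0, zero_smul]
      exact norm_eq_zero.1 h0
    · refine ⟨(normLog W)⁻¹ • (Complex.I • cfc Complex.log W),
        ?_, ?_, ?_⟩
      · rw [IsSelfAdjoint, star_smul, (isSelfAdjoint_I_smul_cfc_log hW).star_eq, star_trivial]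
      · rw [norm_smul, norm_inv, normLog, norm_norm]
        exact inv_mul_cancel₀ h0
      · rw [smul_inv_smul₀ h0]
  refine ⟨norm_nonneg _, fun _ => A, _, ⟨aestronglyMeasurable_const, fun _ _ => hA,
    fun _ _ => hA1⟩, isTimeOrderedExp_exp A _, ?_⟩
  have : normLog W • (-(Complex.I • A)) = cfc Complex.log W := by
    rw [smul_neg, smul_comm, ← hWA, smul_smul, Complex.I_mul_I, neg_smul, one_smul, neg_neg]
  rw [this, exp_cfc_log hW]
  exact h

/-- The unitaries that conjugate `ρ` into `σ`. -/
def conjugators (ρ σ : H →L[ℂ] H) : Set (H →L[ℂ] H) :=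
  {W | W ∈ unitary (H →L[ℂ] H) ∧ σ = W * ρ * star W}

theorem isCompact_conjugators [Nontrivial H] (ρ σ : H →L[ℂ] H) :
    IsCompact (conjugators ρ σ) := by
  have : ProperSpace (H →L[ℂ] H) := FiniteDimensional.proper ℂ _
  refine Metric.isCompact_of_isClosed_isBounded ?_ ?_
  · exact isClosed_unitary.inter
      (isClosed_eq continuous_const ((continuous_id.mul continuous_const).mul continuous_star))
  · refine (Metric.isBounded_closedBall (x := (0 : H →L[ℂ] H)) (r := 1)).subset fun W hW => ?_
    simpa using (CStarRing.norm_of_mem_unitary hW.1).le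

/-- The charging distance of unitarily equivalent operators is attained, and is the least
`‖i ln W‖` over the unitaries `W` that conjugate the one into the other. -/
theorem isLeast_chargingDistance [Nontrivial H] (hne : (conjugators ρ σ).Nonempty) :
    IsLeast (chargingTimes ρ σ) (chargingDistance ρ σ) ∧
      IsLeast (normLog '' conjugators ρ σ) (chargingDistance ρ σ) := by
  obtain ⟨W, hW, hmin⟩ := (isCompact_conjugators ρ σ).exists_isMinOn hne
    (continuousOn_normLog.mono fun W hW => hW.1)
  have hleast : IsLeast (chargingTimes ρ σ) (normLog W) := by
    refine ⟨normLog_mem_chargingTimes hW.1 hW.2, ?_⟩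
    rintro T ⟨hT, V, U, hV, hU, hσ⟩
    exact (hmin ⟨hU.mem_unitary hV ⟨hT, le_rfl⟩, hσ⟩).trans (hU.normLog_le hT hV)
  have hD : chargingDistance ρ σ = normLog W := hleast.csInf_eq
  rw [hD]
  exact ⟨hleast, mem_image_of_mem _ hW, forall_mem_image.2 fun _ hW' => hmin hW'⟩

end Times

-- On the zero space no operator has norm one, so there would be no charging Hamiltonian at all;
-- trace one excludes this case.
omit [FiniteDimensional ℂ H] [CompleteSpace H] in
theorem IsDensityOperator.nontrivial {ρ : H →L[ℂ] H} (hρ : IsDensityOperator ρ) :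
    Nontrivial H := by
  by_contra h
  rw [not_nontrivial_iff_subsingleton] at h
  have : (ρ : H →ₗ[ℂ] H) = 0 := Subsingleton.elim _ _
  simpa [this] using hρ.2

/-! ### Conjugators and eigenvectors in an orthonormal basis. -/

section Basis

variable {ι : Type*} [Fintype ι] {b c : OrthonormalBasis ι ℂ H}

omit [FiniteDimensional ℂ H] [CompleteSpace H] in
theorem sum_smul_ketBra_apply (a : ι → ℂ) (b : OrthonormalBasis ι ℂ H) (c : ι → H) (j : ι) :
    (∑ i, a i • ketBra (c i) (b i)) (b j) = a j • c j := by
  classical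
  simp [ketBra, sum_apply, b.inner_eq_ite]

theorem mem_unitary_of_orthonormal {W : H →L[ℂ] H} (h : Orthonormal ℂ fun j => W (b j)) :
    W ∈ unitary (H →L[ℂ] H) := by
  refine mem_unitary_of_star_mul_self ?_
  refine (ContinuousLinearMap.norm_map_iff_adjoint_comp_self W).1 fun x => ?_
  have hb : Orthonormal ℂ b.toBasis := by simp
  exact ((W : H →ₗ[ℂ] H).isometryOfOrthonormal hb (by simpa using! h)).norm_map x

omit [FiniteDimensional ℂ H] in
theorem norm_map_of_mem_unitary {W : H →L[ℂ] H} (h : W ∈ unitary (H →L[ℂ] H)) (x : H) :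
    ‖W x‖ = ‖x‖ :=
  (ContinuousLinearMap.norm_map_iff_adjoint_comp_self W).2 (Unitary.mem_iff.1 h).1 x

omit [FiniteDimensional ℂ H] [CompleteSpace H] in
theorem ext_basis {A B : H →L[ℂ] H} (b : OrthonormalBasis ι ℂ H) (h : ∀ j, A (b j) = B (b j)) :
    A = B := by
  have : (A : H →ₗ[ℂ] H) = B := b.toBasis.ext fun j => by simpa using h j
  exact ContinuousLinearMap.coe_injective this

omit [FiniteDimensional ℂ H] in
theorem mem_conjugators_iff (a : ι → ℂ) (σ W : H →L[ℂ] H) :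
    W ∈ conjugators (∑ i, a i • ketBra (b i) (b i)) σ ↔
      W ∈ unitary (H →L[ℂ] H) ∧ ∀ j, σ (W (b j)) = a j • W (b j) := by
  refine and_congr_right fun hW => ?_
  have h1 : ∀ ρ : H →L[ℂ] H, σ = W * ρ * star W ↔ σ * W = W * ρ := fun ρ =>
    ⟨fun h => by rw [h, mul_assoc, (Unitary.mem_iff.1 hW).1, mul_one],
      fun h => by rw [← h, mul_assoc, (Unitary.mem_iff.1 hW).2, mul_one]⟩
  rw [h1]
  refine ⟨fun h j => ?_, fun h => ext_basis b fun j => ?_⟩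
  · have := congrArg (fun A : H →L[ℂ] H => A (b j)) h
    change σ (W (b j)) = W ((∑ i, a i • ketBra (b i) (b i)) (b j)) at this
    rwa [sum_smul_ketBra_apply, map_smul] at this
  · change σ (W (b j)) = W ((∑ i, a i • ketBra (b i) (b i)) (b j))
    rw [sum_smul_ketBra_apply, map_smul, h j]

-- In coordinates the eigenvalue equation reads `(a j - μ) ⟪c j, y⟫ = 0`. Both the block case and
-- the simple-spectrum case identify their eigenspaces through this.
omit [FiniteDimensional ℂ H] [CompleteSpace H] in
theorem sum_smul_ketBra_apply_eq_smul_iff (a : ι → ℂ) (c : OrthonormalBasis ι ℂ H) (μ : ℂ)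
    (y : H) : (∑ i, a i • ketBra (c i) (c i)) y = μ • y ↔ ∀ j, a j ≠ μ → inner ℂ (c j) y = 0 := by
  classical
  have hj : ∀ j, inner ℂ (c j) ((∑ i, a i • ketBra (c i) (c i)) y) = a j * inner ℂ (c j) y := by
    intro j
    simp [ketBra, sum_apply, c.inner_eq_ite]
  constructor
  · intro h j hne
    have := hj j
    rw [h, inner_smul_right] at this
    by_contra h0
    exact hne (mul_right_cancel₀ h0 this).symm
  · intro h
    refine InnerProductSpace.ext_inner_left_basis c.toBasis fun j => ?_
    rw [OrthonormalBasis.coe_toBasis, hj, inner_smul_right]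
    rcases eq_or_ne (a j) μ with h1 | h1
    · rw [h1]
    · rw [h j h1, mul_zero, mul_zero]

end Basis

/-! ### Conjugators of spectral sums with degenerate eigenvalues. -/

section Blocks

variable {m : ℕ} {n : Fin m → ℕ} {r : Fin m → ℝ}

omit [FiniteDimensional ℂ H] [CompleteSpace H] in
theorem spectralSum_eq (r : Fin m → ℝ) (b : OrthonormalBasis (Σ i, Fin (n i)) ℂ H) :
    spectralSum r b = ∑ j, (r j.1 : ℂ) • ketBra (b j) (b j) := by
  rw [Fintype.sum_sigma]
  simp [spectralSum, Finset.smul_sum]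

omit [FiniteDimensional ℂ H] [CompleteSpace H] in
theorem mem_blockSpan_iff (c : OrthonormalBasis (Σ i, Fin (n i)) ℂ H) (i : Fin m) (y : H) :
    y ∈ blockSpan c i ↔ ∀ j, j.1 ≠ i → inner ℂ (c j) y = 0 := by
  constructor
  · intro hy j hj
    induction hy using Submodule.span_induction with
    | mem x hx =>
      obtain ⟨k, rfl⟩ := hx
      exact c.orthonormal.2 fun h => hj (congrArg Sigma.fst h)
    | zero => simp
    | add x y _ _ hx hy => rw [inner_add_right, hx, hy, add_zero]
    | smul a x _ hx => rw [inner_smul_right, hx, mul_zero]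
  · intro h
    rw [← c.sum_repr' y]
    refine Submodule.sum_mem _ fun j _ => ?_
    by_cases hj : j.1 = i
    · obtain ⟨j, k⟩ := j
      obtain rfl : j = i := hj
      exact Submodule.smul_mem _ _ (Submodule.subset_span ⟨k, rfl⟩)
    · rw [h j hj, zero_smul]
      exact Submodule.zero_mem _

omit [FiniteDimensional ℂ H] [CompleteSpace H] in
theorem spectralSum_apply_eq_smul_iff (hr : Function.Injective r)
    (c : OrthonormalBasis (Σ i, Fin (n i)) ℂ H) (i : Fin m) (y : H) :
    spectralSum r c y = (r i : ℂ) • y ↔ y ∈ blockSpan c i := by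
  rw [spectralSum_eq, sum_smul_ketBra_apply_eq_smul_iff, mem_blockSpan_iff]
  simp [hr.eq_iff]

omit [FiniteDimensional ℂ H] [CompleteSpace H] in
theorem mem_blockSpan (c : OrthonormalBasis (Σ i, Fin (n i)) ℂ H) (i : Fin m) (k : Fin (n i)) :
    c ⟨i, k⟩ ∈ blockSpan c i :=
  Submodule.subset_span ⟨k, rfl⟩

omit [FiniteDimensional ℂ H] [CompleteSpace H] in
theorem map_mem_blockSpan {b : OrthonormalBasis (Σ i, Fin (n i)) ℂ H} {A : H →L[ℂ] H}
    {i : Fin m} {K : Submodule ℂ H} (h : ∀ k, A (b ⟨i, k⟩) ∈ K) {y : H}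
    (hy : y ∈ blockSpan b i) : A y ∈ K := by
  have hle : blockSpan b i ≤ K.comap (A : H →ₗ[ℂ] H) := by
    refine Submodule.span_le.2 ?_
    rintro _ ⟨k, rfl⟩
    exact h k
  exact hle hy

omit [FiniteDimensional ℂ H] in
/-- A unitary conjugates one spectral sum into another exactly if it maps the eigenspaces of the
first into those of the second. -/
theorem mem_conjugators_spectralSum_iff (hr : Function.Injective r)
    (b c : OrthonormalBasis (Σ i, Fin (n i)) ℂ H) (W : H →L[ℂ] H) :
    W ∈ conjugators (spectralSum r b) (spectralSum r c) ↔
      W ∈ unitary (H →L[ℂ] H) ∧ ∀ i, ∀ y ∈ blockSpan b i, W y ∈ blockSpan c i := by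
  rw [spectralSum_eq r b, mem_conjugators_iff]
  refine and_congr_right fun _ => ?_
  constructor
  · intro h i y hy
    exact map_mem_blockSpan (fun k => (spectralSum_apply_eq_smul_iff hr c i _).1 (h ⟨i, k⟩)) hy
  · rintro h ⟨i, k⟩
    exact (spectralSum_apply_eq_smul_iff hr c i _).2 (h i _ (mem_blockSpan b i k))

omit [FiniteDimensional ℂ H] [CompleteSpace H] in
theorem inner_eq_zero_of_mem_blockSpan (c : OrthonormalBasis (Σ i, Fin (n i)) ℂ H)
    {i j : Fin m} (hij : i ≠ j) {x y : H} (hx : x ∈ blockSpan c i) (hy : y ∈ blockSpan c j) :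
    inner ℂ x y = 0 := by
  induction hx using Submodule.span_induction with
  | mem x hx =>
    obtain ⟨k, rfl⟩ := hx
    exact (mem_blockSpan_iff c j y).1 hy ⟨i, k⟩ hij
  | zero => simp
  | add x x' _ _ hx hx' => rw [inner_add_left, hx, hx', add_zero]
  | smul a x _ hx => rw [inner_smul_left, hx, mul_zero]

omit [CompleteSpace H] in
theorem blockSum_apply (c : OrthonormalBasis (Σ i, Fin (n i)) ℂ H)
    (U : ∀ i, blockSpan c i ≃ₗᵢ[ℂ] blockSpan c i) {i : Fin m} (y : blockSpan c i) :
    blockSum (blockSpan c) U y = U i y := by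
  simp only [blockSum, sum_apply]
  rw [Finset.sum_eq_single i]
  · simp
  · intro j _ hji
    have : (blockSpan c j).orthogonalProjectionOnto (y : H) = 0 :=
      Submodule.orthogonalProjectionOnto_eq_zero_iff.2 fun x hx =>
        inner_eq_zero_of_mem_blockSpan c hji hx y.2
    simp [this]
  · simp

omit [FiniteDimensional ℂ H] [CompleteSpace H] in
theorem sum_ketBra_apply (b c : OrthonormalBasis (Σ i, Fin (n i)) ℂ H) (j : Σ i, Fin (n i)) :
    (∑ i, ∑ k, ketBra (c ⟨i, k⟩) (b ⟨i, k⟩)) (b j) = c j := by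
  have : ∑ i, ∑ k, ketBra (c ⟨i, k⟩) (b ⟨i, k⟩) = ∑ j, (1 : ℂ) • ketBra (c j) (b j) := by
    simp [Fintype.sum_sigma]
  rw [this, sum_smul_ketBra_apply (fun _ => 1), one_smul]

theorem sum_ketBra_mem_unitary (b c : OrthonormalBasis (Σ i, Fin (n i)) ℂ H) :
    ∑ i, ∑ k, ketBra (c ⟨i, k⟩) (b ⟨i, k⟩) ∈ unitary (H →L[ℂ] H) := by
  refine mem_unitary_of_orthonormal (b := b) ?_
  simp only [sum_ketBra_apply]
  exact c.orthonormal

/-- The conjugating unitaries are the products of a block-diagonal unitary and the transition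
operator between the two eigenbases. -/
theorem conjugators_spectralSum (hr : Function.Injective r)
    (b c : OrthonormalBasis (Σ i, Fin (n i)) ℂ H) :
    conjugators (spectralSum r b) (spectralSum r c) =
      range fun U : ∀ i, blockSpan c i ≃ₗᵢ[ℂ] blockSpan c i =>
        blockSum (blockSpan c) U * ∑ i, ∑ k, ketBra (c ⟨i, k⟩) (b ⟨i, k⟩) := by
  set S := ∑ i, ∑ k, ketBra (c ⟨i, k⟩) (b ⟨i, k⟩) with hS
  have hSb : ∀ j, S (b j) = c j := sum_ketBra_apply b c
  have hSu : S ∈ unitary (H →L[ℂ] H) := sum_ketBra_mem_unitary b c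
  ext W
  rw [mem_conjugators_spectralSum_iff hr]
  constructor
  · rintro ⟨hW, hmap⟩
    have hSc : ∀ j, star S (c j) = b j := fun j => by
      rw [← hSb, ← mul_apply_eq_comp, (Unitary.mem_iff.1 hSu).1,
        one_apply_eq_self]
    -- `S` sends the blocks of `b` to those of `c`, as `W` does, so `W S†` is a unitary preserving
    -- each block of `c`. Its restrictions are isometries, hence onto by finite dimension, and are
    -- the required block unitaries.
    have hBu : W * star S ∈ unitary (H →L[ℂ] H) := mul_mem hW (Unitary.star_mem hSu)
    have hB : ∀ i, ∀ y ∈ blockSpan c i, (W * star S) y ∈ blockSpan c i := fun i y hy =>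
      map_mem_blockSpan (fun k => by
        rw [mul_apply_eq_comp, hSc]
        exact hmap i _ (mem_blockSpan b i k)) hy
    let U : ∀ i, blockSpan c i ≃ₗᵢ[ℂ] blockSpan c i := fun i =>
      LinearIsometry.toLinearIsometryEquiv
        ⟨((W * star S : H →L[ℂ] H) : H →ₗ[ℂ] H).restrict (hB i),
          fun y => norm_map_of_mem_unitary hBu y⟩ rfl
    refine ⟨U, ext_basis b fun j => ?_⟩
    have hU : blockSum (blockSpan c) U (c j) = (W * star S) (c j) :=
      blockSum_apply c U ⟨c j, mem_blockSpan c j.1 j.2⟩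
    change blockSum (blockSpan c) U (S (b j)) = W (b j)
    rw [hSb, hU, mul_apply_eq_comp, hSc]
  · rintro ⟨U, rfl⟩
    have happ : ∀ j, (blockSum (blockSpan c) U * S) (b j) =
        U j.1 ⟨c j, mem_blockSpan c j.1 j.2⟩ := fun j => by
      rw [mul_apply_eq_comp, hSb]
      exact blockSum_apply c U ⟨c j, mem_blockSpan c j.1 j.2⟩
    refine ⟨mem_unitary_of_orthonormal (b := b) ?_, fun i y hy => map_mem_blockSpan (fun k => ?_) hy⟩
    · simp only [happ]
      refine ⟨fun j => ?_, ?_⟩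
      · rw [Submodule.norm_coe, LinearIsometryEquiv.norm_map]
        exact c.orthonormal.1 j
      · rintro ⟨i, k⟩ ⟨i', k'⟩ hne
        rcases eq_or_ne i i' with rfl | hii
        · rw [← Submodule.coe_inner, LinearIsometryEquiv.inner_map_map]
          exact c.orthonormal.2 hne
        · exact inner_eq_zero_of_mem_blockSpan c hii (Subtype.coe_prop _) (Subtype.coe_prop _)
    · rw [happ]
      exact Subtype.coe_prop _

theorem conjugators_spectralSum_nonempty (hr : Function.Injective r)
    (b c : OrthonormalBasis (Σ i, Fin (n i)) ℂ H) :
    (conjugators (spectralSum r b) (spectralSum r c)).Nonempty := by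
  rw [conjugators_spectralSum hr]
  exact range_nonempty_iff_nonempty.2 ⟨fun _ => .refl _ _⟩

end Blocks

/-! ### Conjugators for simple spectrum. -/

/-- In the non-degenerate case the conjugating unitaries differ only by phases. -/
theorem conjugators_of_injective {ι : Type*} [Fintype ι] {r : ι → ℝ} (hr : Function.Injective r)
    (b c : OrthonormalBasis ι ℂ H) :
    conjugators (∑ i, (r i : ℂ) • ketBra (b i) (b i)) (∑ i, (r i : ℂ) • ketBra (c i) (c i)) =
      range fun φ : ι → ℝ => ∑ i, Complex.exp (Complex.I * (φ i : ℂ)) • ketBra (c i) (b i) := by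
  ext W
  rw [mem_conjugators_iff (fun i => (r i : ℂ))]
  simp only [sum_smul_ketBra_apply_eq_smul_iff (fun i => (r i : ℂ))]
  constructor
  · rintro ⟨hW, h⟩
    -- `W (b j)` lies in the eigenspace of `σ` for the simple eigenvalue `r j`, which is the line
    -- through `c j`. The coefficient has modulus one, and its argument is the phase.
    have hWb : ∀ j, W (b j) = inner ℂ (c j) (W (b j)) • c j := fun j => by
      conv_lhs => rw [← c.sum_repr' (W (b j))]
      refine Finset.sum_eq_single j (fun i _ hij => ?_) (by simp)
      rw [h j i (by simpa using hr.ne hij), zero_smul]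
    have hnorm : ∀ j, ‖inner ℂ (c j) (W (b j))‖ = 1 := fun j => by
      have := congrArg norm (hWb j)
      rw [norm_smul, norm_map_of_mem_unitary hW, b.orthonormal.1, c.orthonormal.1, mul_one] at this
      exact this.symm
    refine ⟨fun j => Complex.arg (inner ℂ (c j) (W (b j))), ext_basis b fun j => ?_⟩
    change (∑ i, _ • ketBra (c i) (b i)) (b j) = _
    have := Complex.norm_mul_exp_arg_mul_I (inner ℂ (c j) (W (b j)))
    rw [hnorm, Complex.ofReal_one, one_mul] at this
    rw [sum_smul_ketBra_apply, mul_comm, this, ← hWb j]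
  · rintro ⟨φ, rfl⟩
    simp only [sum_smul_ketBra_apply]
    refine ⟨mem_unitary_of_orthonormal (b := b) ?_, fun j i hij => ?_⟩
    · simp only [sum_smul_ketBra_apply]
      refine ⟨fun j => ?_, fun i j hij => ?_⟩
      · rw [norm_smul, mul_comm Complex.I, Complex.norm_exp_ofReal_mul_I, c.orthonormal.1, mul_one]
      · change inner ℂ (_ • c i) (_ • c j) = 0
        rw [inner_smul_left, inner_smul_right, c.orthonormal.2 hij, mul_zero, mul_zero]
    · rw [inner_smul_right, c.orthonormal.2 (fun h => hij (by rw [h])), mul_zero]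

theorem conjugators_of_injective_nonempty {ι : Type*} [Fintype ι] {r : ι → ℝ}
    (hr : Function.Injective r) (b c : OrthonormalBasis ι ℂ H) :
    (conjugators (∑ i, (r i : ℂ) • ketBra (b i) (b i))
      (∑ i, (r i : ℂ) • ketBra (c i) (c i))).Nonempty := by
  rw [conjugators_of_injective hr]
  exact range_nonempty _

end QuantumCharging

/-! ### The main theorem. -/

open QuantumCharging in
theorem theorem4 {H : Type*} [NormedAddCommGroup H] [InnerProductSpace ℂ H]
    [FiniteDimensional ℂ H] [CompleteSpace H] :
    -- the formula for the charging distance, the minimum in its definition being attained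
    (∀ (m : ℕ) (n : Fin m → ℕ) (r : Fin m → ℝ) (b c : OrthonormalBasis (Σ i, Fin (n i)) ℂ H)
        (ρ σ : H →L[ℂ] H),
        Function.Injective r → IsDensityOperator ρ → IsDensityOperator σ →
        ρ = spectralSum r b → σ = spectralSum r c →
        IsLeast (chargingTimes ρ σ) (chargingDistance ρ σ) ∧
        IsLeast
          {x : ℝ | ∃ U : ∀ i, blockSpan c i ≃ₗᵢ[ℂ] blockSpan c i,
            x = normLog (blockSum (blockSpan c) U * ∑ i, ∑ k, ketBra (c ⟨i, k⟩) (b ⟨i, k⟩))}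
          (chargingDistance ρ σ)) ∧
    -- the distance depends only on the eigenspaces, not on the eigenvalues
    (∀ (m : ℕ) (n : Fin m → ℕ) (r r' : Fin m → ℝ)
        (b c b' c' : OrthonormalBasis (Σ i, Fin (n i)) ℂ H) (ρ σ ρ' σ' : H →L[ℂ] H),
        Function.Injective r → Function.Injective r' →
        IsDensityOperator ρ → IsDensityOperator σ →
        IsDensityOperator ρ' → IsDensityOperator σ' →
        ρ = spectralSum r b → σ = spectralSum r c →
        ρ' = spectralSum r' b' → σ' = spectralSum r' c' →
        (∀ i, blockSpan b' i = blockSpan b i) → (∀ i, blockSpan c' i = blockSpan c i) →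
        chargingDistance ρ' σ' = chargingDistance ρ σ) ∧
    -- the non-degenerate case
    (∀ (d : ℕ) (r : Fin d → ℝ) (b c : OrthonormalBasis (Fin d) ℂ H) (ρ σ : H →L[ℂ] H),
        Function.Injective r → IsDensityOperator ρ → IsDensityOperator σ →
        ρ = ∑ i, (r i : ℂ) • ketBra (b i) (b i) → σ = ∑ i, (r i : ℂ) • ketBra (c i) (c i) →
        IsLeast
          {x : ℝ | ∃ φ : Fin d → ℝ,
            x = normLog (∑ i, Complex.exp (Complex.I * (φ i : ℂ)) • ketBra (c i) (b i))}
          (chargingDistance ρ σ)) := by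
  refine ⟨?_, ?_, ?_⟩
  · rintro m n r b c ρ σ hr hρ - rfl rfl
    have := hρ.nontrivial
    obtain ⟨h1, h2⟩ := isLeast_chargingDistance (conjugators_spectralSum_nonempty hr b c)
    refine ⟨h1, ?_⟩
    rw [conjugators_spectralSum hr, ← Set.range_comp] at h2
    convert h2 using 1
    ext x
    simp [eq_comm]
  · rintro m n r r' b c b' c' ρ σ ρ' σ' hr hr' hρ - - - rfl rfl rfl rfl hb hc
    have := hρ.nontrivial
    -- The eigenspace criterion for conjugators does not mention the eigenvalues, so both pairs have
    -- the same conjugators and hence the same minimum.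
    have heq : conjugators (spectralSum r' b') (spectralSum r' c') =
        conjugators (spectralSum r b) (spectralSum r c) := by
      ext W
      simp only [mem_conjugators_spectralSum_iff hr, mem_conjugators_spectralSum_iff hr', hb, hc]
    have h := (isLeast_chargingDistance (conjugators_spectralSum_nonempty hr' b' c')).2
    rw [heq] at h
    exact h.unique (isLeast_chargingDistance (conjugators_spectralSum_nonempty hr b c)).2
  · rintro d r b c ρ σ hr hρ - rfl rfl
    have := hρ.nontrivial
    have h := (isLeast_chargingDistance (conjugators_of_injective_nonempty hr b c)).2
    rw [conjugators_of_injective hr, ← Set.range_comp] at h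
    convert h using 1
    ext x
    simp [eq_comm]
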